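/- Let $n\ge 1$. Let $B_n$ be Artin's braid group on $n$ strands, with generators $\sigma_1,\dots,\sigma_{n-1}$, and let $\mathscr H_n(z)$ be the Hecke algebra, i.e. the quotient of the group algebra $\mathbf Z[z][B_n]$ by the relations $\sigma_i-\sigma_i^{-1}=z$ for all $i$. A braid and its image in $\mathscr H_n(z)$ are denoted by the same symbol. (1) There is a unique family of $\mathbf Z[z]$-linear maps $\mathrm{Tr}\colon\mathscr H_n(z)\to\mathbf Z[z,T]$, $n\ge1$ (Ocneanu's trace), such that $\mathrm{Tr}(1)=1$, $\mathrm{Tr}(ab)=\mathrm{Tr}(ba)$, $\mathrm{Tr}$ is compatible with the natural maps $\mathscr H_n(z)\to\mathscr H_{n+1}(z)$, $\sigma_i\mapsto\sigma_i$, and $\mathrm{Tr}(a\sigma_n)=T\,\mathrm{Tr}(a)$ in $\mathscr H_{n+1}(z)$ for every $a$ coming from $\mathscr H_n(z)$. For $x\in\mathscr H_n(z)$ define the framed Homfly polynomial $$H_x(v,z)=\left(\frac{v^{-1}-v}{z}\right)^{n-1}\cdot\mathrm{Tr}(x)\Big|_{T=\frac{z}{1-v^2}},$$ and let $L_x(z)$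 be $z^{n-1}$ times the coefficient of $v^{1-n}$ in $H_x(v,z)$. For a braid $\beta$ let $\beta^*$ be the braid obtained by writing the letters of a braid word for $\beta$ in reverse order, and extend $\beta\mapsto\beta^*$ linearly to $\mathscr H_n(z)$. The left inner product is the $\mathbf Z[z]$-bilinear form $\langle x,y\rangle_L=L_{xy^*}(z)$ on $\mathscr H_n(z)$. For a permutation $\pi\in S_n$ let $\nu_\pi\in B_n$ be the negative permutation braid of $\pi$: the braid with underlying permutation $\pi$ in which all crossings are negative and any two strands cross at most once, i.e. the product of the $\sigma_i^{-1}$ along a reduced word for $\pi$ in the adjacent transpositions. (2) The family $\mathbf N=\{\nu_\pi\}_{\pi\in S_n}$ is a basis of the $\mathbf Z[z]$-module $\mathscr H_n(z)$, and it is orthonormal with respect to the left inner product: for all $\pi,\kappa\in S_n$, $$\langle\nu_\pi,\nu_\kappa\rangle_L=\begin{cases}1,&\pi=\kappa,\\0,&\pi\ne\kappa.\end{cases}$$ -/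

import Mathlib

open Polynomial

noncomputable section

namespace HeckeInner

/-!
Throughout, `m` is the number of braid generators, so that `n = m + 1 ≥ 1` is the number of
strands.
-/

/-- The relators of Artin's presentation of the braid group on `m + 1` strands, with generators
`σ_i`, `i : Fin m`. -/
inductive IsBraidRelator (m : ℕ) : FreeGroup (Fin m) → Prop
  | far (i j : Fin m) (h : i.val + 2 ≤ j.val) : IsBraidRelator m
      (FreeGroup.of i * FreeGroup.of j * (FreeGroup.of j * FreeGroup.of i)⁻¹)
  | near (i j : Fin m) (h : i.val + 1 = j.val) : IsBraidRelator m
      (FreeGroup.of i * FreeGroup.of j * FreeGroup.of i *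
        (FreeGroup.of j * FreeGroup.of i * FreeGroup.of j)⁻¹)

/-- Artin's braid group `B_{m+1}` on `m + 1` strands. -/
abbrev BraidGroup (m : ℕ) : Type := PresentedGroup {r | IsBraidRelator m r}

/-- The Artin generator `σ_i` of the braid group. -/
def sigma {m : ℕ} (i : Fin m) : BraidGroup m := PresentedGroup.of i

theorem sigma_far {m : ℕ} (i j : Fin m) (h : i.val + 2 ≤ j.val) :
    sigma i * sigma j = sigma j * sigma i :=
  mul_inv_eq_one.1 (PresentedGroup.one_of_mem (rels := {r | IsBraidRelator m r}) (.far i j h))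

theorem sigma_near {m : ℕ} (i j : Fin m) (h : i.val + 1 = j.val) :
    sigma i * sigma j * sigma i = sigma j * sigma i * sigma j :=
  mul_inv_eq_one.1 (PresentedGroup.one_of_mem (rels := {r | IsBraidRelator m r}) (.near i j h))

/-- A homomorphism out of the braid group, given by the images of the generators. -/
def braidLift {m : ℕ} {G : Type*} [Group G] (f : Fin m → G)
    (far : ∀ i j : Fin m, i.val + 2 ≤ j.val → f i * f j = f j * f i)
    (near : ∀ i j : Fin m, i.val + 1 = j.val → f i * f j * f i = f j * f i * f j) :
    BraidGroup m →* G :=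
  PresentedGroup.toGroup (f := f) (by
    rintro r (⟨i, j, h⟩ | ⟨i, j, h⟩)
    · simpa [mul_inv_eq_one, -mul_inv_rev] using far i j h
    · simpa [mul_inv_eq_one, -mul_inv_rev] using near i j h)

/-- The inclusion of the braid group on `m + 1` strands into the one on `m + 2` strands
(adding a trivial last strand), `σ_i ↦ σ_i`. -/
def braidIncl (m : ℕ) : BraidGroup m →* BraidGroup (m + 1) :=
  braidLift (fun i => sigma i.castSucc)
    (fun i j h => sigma_far _ _ (by simpa using h))
    (fun i j h => sigma_near _ _ (by simpa using h))

/-- Reversal of braid words, as a homomorphism to the opposite group: it is the identity on the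
generators. -/
def braidRevHom (m : ℕ) : BraidGroup m →* (BraidGroup m)ᵐᵒᵖ :=
  braidLift (fun i => MulOpposite.op (sigma i))
    (fun i j h => by simp only [← MulOpposite.op_mul, sigma_far i j h])
    (fun i j h => by
      simp only [← MulOpposite.op_mul]
      rw [← mul_assoc, ← mul_assoc, sigma_near i j h])

/-- The braid `β*`: the letters of a braid word for `β`, written in reverse order. -/
def braidRev {m : ℕ} (β : BraidGroup m) : BraidGroup m := (braidRevHom m β).unop

theorem braidRev_sigma {m : ℕ} (i : Fin m) : braidRev (sigma i) = sigma i := by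
  simp [braidRev, braidRevHom, braidLift, sigma]

theorem braidRev_mul {m : ℕ} (α β : BraidGroup m) :
    braidRev (α * β) = braidRev β * braidRev α := by
  simp [braidRev]

theorem braidRev_inv {m : ℕ} (β : BraidGroup m) : braidRev β⁻¹ = (braidRev β)⁻¹ := by
  simp [braidRev]

/-- The relations `σ_i - σ_i⁻¹ = z` imposed on the group algebra over `ℤ[z]` of the braid group. -/
inductive HeckeRel (m : ℕ) :
    MonoidAlgebra ℤ[X] (BraidGroup m) → MonoidAlgebra ℤ[X] (BraidGroup m) → Prop
  | skein (i : Fin m) : HeckeRel m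
      (MonoidAlgebra.of ℤ[X] (BraidGroup m) (sigma i) -
        MonoidAlgebra.of ℤ[X] (BraidGroup m) (sigma i)⁻¹)
      (algebraMap ℤ[X] _ X)

/-- The Hecke algebra `H_{m+1}(z)` over `ℤ[z]` on `m + 1` strands; the variable `z` is
`X : ℤ[X]`. -/
def Hecke (m : ℕ) : Type := RingQuot (HeckeRel m)

instance (m : ℕ) : Ring (Hecke m) := inferInstanceAs (Ring (RingQuot (HeckeRel m)))

instance (m : ℕ) : Algebra ℤ[X] (Hecke m) :=
  inferInstanceAs (Algebra ℤ[X] (RingQuot (HeckeRel m)))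

/-- The natural representation of the braid group in the Hecke algebra. -/
def toHecke (m : ℕ) : BraidGroup m →* Hecke m :=
  (RingQuot.mkAlgHom ℤ[X] (HeckeRel m) : _ →* RingQuot (HeckeRel m)).comp
    (MonoidAlgebra.of ℤ[X] (BraidGroup m))

theorem toHecke_skein {m : ℕ} (i : Fin m) :
    toHecke m (sigma i) - toHecke m (sigma i)⁻¹ = algebraMap ℤ[X] (Hecke m) X := by
  have h := RingQuot.mkAlgHom_rel ℤ[X] (HeckeRel.skein i)
  rw [map_sub, AlgHom.commutes] at h
  exact h

/-- An algebra homomorphism out of the Hecke algebra, given by a multiplicative map on braids that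
respects the relations `σ_i - σ_i⁻¹ = z`. -/
def heckeLift {m : ℕ} {A : Type*} [Ring A] [Algebra ℤ[X] A] (f : BraidGroup m →* A)
    (hf : ∀ i, f (sigma i) - f (sigma i)⁻¹ = algebraMap ℤ[X] A X) : Hecke m →ₐ[ℤ[X]] A :=
  RingQuot.liftAlgHom ℤ[X] ⟨MonoidAlgebra.lift ℤ[X] A (BraidGroup m) f, by
    rintro _ _ ⟨i⟩
    rw [map_sub, MonoidAlgebra.lift_of, MonoidAlgebra.lift_of, AlgHom.commutes]
    exact hf i⟩

theorem heckeLift_toHecke {m : ℕ} {A : Type*} [Ring A] [Algebra ℤ[X] A] (f : BraidGroup m →* A)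
    (hf : ∀ i, f (sigma i) - f (sigma i)⁻¹ = algebraMap ℤ[X] A X) (β : BraidGroup m) :
    heckeLift f hf (toHecke m β) = f β := by
  refine (RingQuot.liftAlgHom_mkAlgHom_apply ℤ[X] _ _ _).trans ?_
  exact MonoidAlgebra.lift_of _ _

/-- The natural map from the Hecke algebra on `m + 1` strands to the one on `m + 2` strands. -/
def heckeIncl (m : ℕ) : Hecke m →ₐ[ℤ[X]] Hecke (m + 1) :=
  heckeLift ((toHecke (m + 1)).comp (braidIncl m)) (fun i => by
    have h : braidIncl m (sigma i) = sigma i.castSucc := by simp [braidIncl, braidLift, sigma]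
    simp only [MonoidHom.comp_apply, map_inv, h]
    exact toHecke_skein i.castSucc)

/-- The `ℤ[z]`-linear extension of `β ↦ β*` to the Hecke algebra, as an algebra homomorphism to
the opposite algebra. -/
def heckeRevHom (m : ℕ) : Hecke m →ₐ[ℤ[X]] (Hecke m)ᵐᵒᵖ :=
  heckeLift ((toHecke m).op.comp (braidRevHom m)) (fun i => by
    have h : braidRevHom m (sigma i) = MulOpposite.op (sigma i) := by
      simp [braidRevHom, braidLift, sigma]
    simp only [MonoidHom.comp_apply, map_inv, h]
    exact congrArg MulOpposite.op (toHecke_skein i))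

/-- The `ℤ[z]`-linear extension of `β ↦ β*` to the Hecke algebra. -/
def heckeRev (m : ℕ) : Hecke m →ₗ[ℤ[X]] Hecke m :=
  (MulOpposite.opLinearEquiv ℤ[X]).symm.toLinearMap ∘ₗ (heckeRevHom m).toLinearMap

theorem heckeRev_toHecke {m : ℕ} (β : BraidGroup m) :
    heckeRev m (toHecke m β) = toHecke m (braidRev β) := by
  change (heckeRevHom m (toHecke m β)).unop = _
  rw [heckeRevHom, heckeLift_toHecke]
  rfl

/-- The defining properties of Ocneanu's trace. The family `Tr` consists of one `ℤ[z]`-linear map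
on the Hecke algebra on `m + 1` strands for each `m`, with values in `ℤ[z, T] = ℤ[z][T]`; the
variable `T` is the outer `X : ℤ[X][X]`. -/
structure IsOcneanuTrace (Tr : ∀ m : ℕ, Hecke m →ₗ[ℤ[X]] ℤ[X][X]) : Prop where
  one : ∀ m, Tr m 1 = 1
  comm : ∀ m (a b : Hecke m), Tr m (a * b) = Tr m (b * a)
  incl : ∀ m (a : Hecke m), Tr (m + 1) (heckeIncl m a) = Tr m a
  markov : ∀ m (a : Hecke m),
    Tr (m + 1) (heckeIncl m a * toHecke (m + 1) (sigma (Fin.last m))) = X * Tr m a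

/-- The field of fractions of `ℤ[z]`. -/
abbrev K : Type := FractionRing ℤ[X]

/-- Constants from `ℤ[z]` in the field of Laurent series in `v` over `K`. -/
def zConst : ℤ[X] →+* LaurentSeries K := (HahnSeries.C).comp (algebraMap ℤ[X] K)

/-- The variable `z` in the field of Laurent series in `v` over `K`. -/
def zVar : LaurentSeries K := zConst X

/-- The variable `v` in the field of Laurent series in `v` over `K`. -/
def vVar : LaurentSeries K := HahnSeries.single 1 1

/-- The framed Homfly polynomial
`H_x(v, z) = ((v⁻¹ - v) / z) ^ (n - 1) * Tr(x)|_{T = z / (1 - v ^ 2)}`, `n = m + 1`,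
computed in the field of Laurent series in `v` over `K`. For braids it is a Laurent polynomial in
`v`, whose coefficients are its coefficients as a Laurent series. -/
def framedHomfly (Tr : ∀ m : ℕ, Hecke m →ₗ[ℤ[X]] ℤ[X][X]) (m : ℕ) (x : Hecke m) :
    LaurentSeries K :=
  ((vVar⁻¹ - vVar) / zVar) ^ m * (Tr m x).eval₂ zConst (zVar / (1 - vVar ^ 2))

/-- The left column `L_x(z)`: `z ^ (n - 1)` times the coefficient of `v ^ (1 - n)` in
`H_x(v, z)`, `n = m + 1`. -/
def leftColumn (Tr : ∀ m : ℕ, Hecke m →ₗ[ℤ[X]] ℤ[X][X]) (m : ℕ) (x : Hecke m) : K :=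
  algebraMap ℤ[X] K X ^ m * (framedHomfly Tr m x).coeff (-(m : ℤ))

theorem leftColumn_add (Tr : ∀ m : ℕ, Hecke m →ₗ[ℤ[X]] ℤ[X][X]) (m : ℕ) (x y : Hecke m) :
    leftColumn Tr m (x + y) = leftColumn Tr m x + leftColumn Tr m y := by
  simp [leftColumn, framedHomfly, eval₂_add, mul_add]

theorem leftColumn_smul (Tr : ∀ m : ℕ, Hecke m →ₗ[ℤ[X]] ℤ[X][X]) (m : ℕ) (c : ℤ[X])
    (x : Hecke m) : leftColumn Tr m (c • x) = c • leftColumn Tr m x := by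
  have h : framedHomfly Tr m (c • x)
      = HahnSeries.C (algebraMap ℤ[X] K c) * framedHomfly Tr m x := by
    simp only [framedHomfly, map_smul, eval₂_smul]
    change _ * (HahnSeries.C (algebraMap ℤ[X] K c) * _) = _
    ring
  rw [leftColumn, h, leftColumn, HahnSeries.C_mul_eq_smul, HahnSeries.coeff_smul,
    smul_eq_mul, Algebra.smul_def c]
  ring

/-- The left inner product `⟨x, y⟩_L = L_{x y*}(z)` on the Hecke algebra, as a `ℤ[z]`-bilinear
map. -/
def leftInner (Tr : ∀ m : ℕ, Hecke m →ₗ[ℤ[X]] ℤ[X][X]) (m : ℕ) :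
    Hecke m →ₗ[ℤ[X]] Hecke m →ₗ[ℤ[X]] K :=
  LinearMap.mk₂ ℤ[X] (fun x y => leftColumn Tr m (x * heckeRev m y))
    (fun x x' y => by rw [add_mul, leftColumn_add])
    (fun c x y => by rw [smul_mul_assoc, leftColumn_smul])
    (fun x y y' => by rw [map_add, mul_add, leftColumn_add])
    (fun c x y => by rw [map_smul, mul_smul_comm, leftColumn_smul])

theorem leftInner_toHecke (Tr : ∀ m : ℕ, Hecke m →ₗ[ℤ[X]] ℤ[X][X]) {m : ℕ}
    (α β : BraidGroup m) :
    leftInner Tr m (toHecke m α) (toHecke m β)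
      = leftColumn Tr m (toHecke m (α * braidRev β)) := by
  rw [leftInner, LinearMap.mk₂_apply, heckeRev_toHecke, ← map_mul]

/-- The adjacent transposition exchanging positions `i` and `i + 1`. -/
def adjSwap {m : ℕ} (i : Fin m) : Equiv.Perm (Fin (m + 1)) := Equiv.swap i.castSucc i.succ

/-- The inversions of a permutation. -/
def inversions {m : ℕ} (π : Equiv.Perm (Fin (m + 1))) : Finset (Fin (m + 1) × Fin (m + 1)) :=
  {p | p.1 < p.2 ∧ π p.2 < π p.1}

theorem mem_inversions {m : ℕ} (π : Equiv.Perm (Fin (m + 1))) (a b : Fin (m + 1)) :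
    (a, b) ∈ inversions π ↔ a < b ∧ π b < π a := by
  simp [inversions]

/-- A word in the adjacent transpositions is reduced for `π` if its product is `π` and its length
is the number of inversions of `π`; as a braid word, this says that two strands cross exactly once
if they form an inversion of `π`, and do not cross otherwise. -/
def IsReducedWord {m : ℕ} (π : Equiv.Perm (Fin (m + 1))) (l : List (Fin m)) : Prop :=
  (l.map adjSwap).prod = π ∧ l.length = (inversions π).card

theorem adjSwap_lt {m : ℕ} (i : Fin m) (a b : Fin (m + 1)) (h : a < b)
    (hne : (a, b) ≠ (i.castSucc, i.succ)) : adjSwap i a < adjSwap i b := by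
  have key : ∀ x : Fin (m + 1), (adjSwap i x).val =
      if x.val = i.val then i.val + 1 else if x.val = i.val + 1 then i.val else x.val := by
    intro x
    rw [adjSwap, Equiv.swap_apply_def]
    simp only [Fin.ext_iff, Fin.val_castSucc, Fin.val_succ]
    split_ifs <;> simp
  rw [Fin.lt_def] at h ⊢
  rw [key, key]
  simp only [ne_eq, Prod.mk.injEq, Fin.ext_iff, Fin.val_castSucc, Fin.val_succ] at hne
  split_ifs <;> omega

theorem adjSwap_adjSwap {m : ℕ} (i : Fin m) (a : Fin (m + 1)) :
    adjSwap i (adjSwap i a) = a := Equiv.swap_apply_self _ _ _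

theorem inversions_mul_adjSwap {m : ℕ} (π : Equiv.Perm (Fin (m + 1))) (i : Fin m)
    (h : π i.succ < π i.castSucc) :
    (inversions (π * adjSwap i)).card + 1 = (inversions π).card := by
  have hmem : (i.castSucc, i.succ) ∈ inversions π := by
    simp [inversions, h]
  rw [← Finset.card_erase_add_one hmem]
  congr 1
  refine Finset.card_bij' (fun p _ => (adjSwap i p.1, adjSwap i p.2))
    (fun p _ => (adjSwap i p.1, adjSwap i p.2)) ?_ ?_ ?_ ?_
  · rintro ⟨a, b⟩ hp
    simp only [mem_inversions, Equiv.Perm.mul_apply,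
      Finset.mem_erase] at hp ⊢
    have hne : (a, b) ≠ (i.castSucc, i.succ) := by
      rintro h'
      obtain ⟨rfl, rfl⟩ := Prod.mk.inj h'
      simp only [adjSwap, Equiv.swap_apply_left, Equiv.swap_apply_right] at hp
      exact absurd hp.2 (not_lt.2 h.le)
    refine ⟨?_, adjSwap_lt i a b hp.1 hne, hp.2⟩
    intro h'
    obtain ⟨h1, h2⟩ := Prod.mk.inj h'
    have e1 : a = i.succ := by
      rw [← adjSwap_adjSwap i a, h1]; exact Equiv.swap_apply_left _ _
    have e2 : b = i.castSucc := by
      rw [← adjSwap_adjSwap i b, h2]; exact Equiv.swap_apply_right _ _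
    rw [e1, e2] at hp
    exact absurd hp.1 (not_lt.2 (Fin.castSucc_lt_succ).le)
  · rintro ⟨a, b⟩ hp
    simp only [mem_inversions, Equiv.Perm.mul_apply,
      Finset.mem_erase, adjSwap_adjSwap] at hp ⊢
    exact ⟨adjSwap_lt i a b hp.2.1 hp.1, hp.2.2⟩
  · rintro ⟨a, b⟩ _
    simp only [adjSwap_adjSwap]
  · rintro ⟨a, b⟩ _
    simp only [adjSwap_adjSwap]

theorem exists_isReducedWord {m : ℕ} (π : Equiv.Perm (Fin (m + 1))) :
    ∃ l : List (Fin m), IsReducedWord π l := by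
  induction hk : (inversions π).card generalizing π with
  | zero =>
    refine ⟨[], ?_, by simp [hk]⟩
    have hmono : StrictMono π := by
      refine Fin.strictMono_iff_lt_succ.2 fun i => ?_
      by_contra hlt
      have hlt' : π i.succ < π i.castSucc :=
        lt_of_le_of_ne (not_lt.1 hlt) (fun e => (Fin.castSucc_lt_succ (i := i)).ne'
          (π.injective e))
      have := inversions_mul_adjSwap π i hlt'
      omega
    have hid := hmono.eq_id
    ext x
    simp [hid]
  | succ k ih =>
    have hex : ∃ i : Fin m, π i.succ < π i.castSucc := by
      by_contra! hall
      have hmono : StrictMono π := Fin.strictMono_iff_lt_succ.2 fun i =>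
        lt_of_le_of_ne (hall i) (fun e => (Fin.castSucc_lt_succ (i := i)).ne (π.injective e))
      have hempty : inversions π = ∅ := by
        refine Finset.eq_empty_of_forall_notMem ?_
        rintro ⟨a, b⟩ hp
        simp only [mem_inversions] at hp
        exact absurd (hmono hp.1) (not_lt.2 hp.2.le)
      rw [hempty] at hk
      simp at hk
    obtain ⟨i, hi⟩ := hex
    have hcard := inversions_mul_adjSwap π i hi
    obtain ⟨l, hl, hlen⟩ := ih (π * adjSwap i) (by omega)
    refine ⟨l ++ [i], ?_, by simp; omega⟩
    rw [List.map_append, List.prod_append, hl]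
    ext x
    simp [adjSwap_adjSwap]

/-- The negative permutation braid `ν_π`: the braid with underlying permutation `π` in which all
crossings are negative and any two strands cross at most once, that is, the product of the
`σ_i⁻¹` along a reduced word for `π` (the braid does not depend on which one is used). -/
def negPermBraid {m : ℕ} (π : Equiv.Perm (Fin (m + 1))) : BraidGroup m :=
  ((exists_isReducedWord π).choose.map fun i => (sigma i)⁻¹).prod

end HeckeInner

end

/-! Write g_i for the inverse generator σ_i⁻¹, so that g_i² = 1 - z g_i and σ_i = g_i + z.
Everything reduces to the canonical trace `tau`, the coefficient of the trivial braid in the basis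
ν_π.

Basis. The expected formulas for right multiplication by g_i on the ν_π define operators on
functions on S_n. They satisfy the Hecke relations (`permRep`), and applying them to δ_1 gives a map
`coords` that sends ν_π to δ_π, hence is surjective. A coset argument spans the algebra by n!
elements, and a surjective endomorphism of a finite free module is injective, so `coords` is
bijective (`coords_bijective`).

Orthonormality. The operators are symmetric matrices, so reversal is adjunction and tau(x y*) is the
dot product of coordinates (`tau_mul_heckeRev`). Symmetry under π ↦ π⁻¹ makes `tau` a trace.

Ocneanu's trace. In terms of g the Markov property has the factor T - z. The trace is the sum over k
of (T - z)^k tau(e_k x), where e_k is the k-th elementary symmetric polynomial in Jucys–Murphy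
elements and is central (`esymmJM_commute`). Uniqueness follows from the decomposition H = H' + H' g
H', where H' is the image of the algebra on one strand fewer and g is the last g_i.

Left column. The lowest v-coefficient amounts to v = 0, hence T = z, where only the term k = 0
survives: L_x = tau(x) (`leftColumn_eq`, `eval_ocneanu`). -/

namespace HeckeInner

/-! ### Inverse generators and reversal. -/

/-- The inverse generator `σ_i⁻¹` in the Hecke algebra. -/
noncomputable def negGen {m : ℕ} (i : Fin m) : Hecke m := toHecke m (sigma i)⁻¹

/-- The scalar `z` in the Hecke algebra. -/
noncomputable def zH (m : ℕ) : Hecke m := algebraMap ℤ[X] (Hecke m) X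

theorem toHecke_sigma {m : ℕ} (i : Fin m) : toHecke m (sigma i) = negGen i + zH m := by
  rw [zH, ← toHecke_skein i, negGen]; abel

theorem negGen_mul_toHecke {m : ℕ} (i : Fin m) : negGen i * toHecke m (sigma i) = 1 := by
  rw [negGen, ← map_mul, inv_mul_cancel, map_one]

theorem negGen_mul_self {m : ℕ} (i : Fin m) :
    negGen i * negGen i = 1 - (X : ℤ[X]) • negGen i := by
  have h := negGen_mul_toHecke i
  rw [toHecke_sigma, mul_add, zH, ← Algebra.commutes, ← Algebra.smul_def] at h
  exact eq_sub_of_add_eq h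

theorem negGen_far {m : ℕ} (i j : Fin m) (h : i.val + 2 ≤ j.val) :
    negGen i * negGen j = negGen j * negGen i := by
  simp only [negGen, ← map_mul, ← mul_inv_rev, sigma_far i j h]

theorem negGen_near {m : ℕ} (i j : Fin m) (h : i.val + 1 = j.val) :
    negGen i * negGen j * negGen i = negGen j * negGen i * negGen j := by
  simp only [negGen, ← map_mul, ← mul_inv_rev, ← mul_assoc, sigma_near i j h]

theorem adjoin_toHecke (m : ℕ) :
    Algebra.adjoin ℤ[X] (Set.range (toHecke m)) = ⊤ := by
  rw [eq_top_iff]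
  rintro x -
  obtain ⟨y, rfl⟩ := RingQuot.mkAlgHom_surjective ℤ[X] (HeckeRel m) x
  induction y using MonoidAlgebra.induction_on with
  | of b => exact Algebra.subset_adjoin ⟨b, rfl⟩
  | add a b ha hb => rw [map_add]; exact add_mem ha hb
  | smul r a ha => rw [map_smul]; exact Subalgebra.smul_mem _ ha r

theorem adjoin_negGen (m : ℕ) :
    Algebra.adjoin ℤ[X] (Set.range (negGen (m := m))) = ⊤ := by
  rw [eq_top_iff, ← adjoin_toHecke, Algebra.adjoin_le_iff]
  rintro _ ⟨b, rfl⟩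
  have hb : b ∈ Subgroup.closure (Set.range (sigma (m := m))) := by
    have := PresentedGroup.closure_range_of {r | IsBraidRelator m r}
    change b ∈ Subgroup.closure (Set.range (PresentedGroup.of (rels := {r | IsBraidRelator m r})))
    rw [this]; trivial
  have hneg : ∀ i, negGen i ∈ Algebra.adjoin ℤ[X] (Set.range (negGen (m := m))) :=
    fun i => Algebra.subset_adjoin ⟨i, rfl⟩
  induction hb using Subgroup.closure_induction'' with
  | mem x hx =>
    obtain ⟨i, rfl⟩ := hx
    rw [SetLike.mem_coe, toHecke_sigma]
    exact add_mem (hneg i) (Subalgebra.algebraMap_mem _ _)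
  | inv_mem x hx =>
    obtain ⟨i, rfl⟩ := hx
    exact hneg i
  | one => rw [map_one]; exact one_mem _
  | mul x y _ _ hx hy => rw [map_mul]; exact mul_mem hx hy

theorem Hecke.induction {m : ℕ} {P : Hecke m → Prop} (scalar : ∀ r, P (algebraMap ℤ[X] _ r))
    (gen : ∀ i, P (negGen i)) (add : ∀ x y, P x → P y → P (x + y))
    (mul : ∀ x y, P x → P y → P (x * y)) (x : Hecke m) : P x := by
  have hx : x ∈ Algebra.adjoin ℤ[X] (Set.range (negGen (m := m))) := by
    rw [adjoin_negGen]; trivial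
  induction hx using Algebra.adjoin_induction with
  | mem x hx => obtain ⟨i, rfl⟩ := hx; exact gen i
  | algebraMap r => exact scalar r
  | add x y _ _ hx hy => exact add x y hx hy
  | mul x y _ _ hx hy => exact mul x y hx hy

theorem heckeRev_algebraMap (m : ℕ) (r : ℤ[X]) :
    heckeRev m (algebraMap ℤ[X] _ r) = algebraMap ℤ[X] _ r := by
  change ((heckeRevHom m) _).unop = _
  rw [AlgHom.commutes]; rfl

theorem heckeRev_mul {m : ℕ} (x y : Hecke m) :
    heckeRev m (x * y) = heckeRev m y * heckeRev m x := by
  change ((heckeRevHom m) _).unop = _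
  rw [map_mul]; rfl

theorem heckeRev_one (m : ℕ) : heckeRev m 1 = 1 := by
  simpa using heckeRev_algebraMap m 1

theorem heckeRev_negGen {m : ℕ} (i : Fin m) : heckeRev m (negGen i) = negGen i := by
  rw [negGen, heckeRev_toHecke, braidRev_inv, braidRev_sigma]

theorem heckeRev_heckeRev {m : ℕ} (x : Hecke m) : heckeRev m (heckeRev m x) = x := by
  induction x using Hecke.induction with
  | scalar r => simp only [heckeRev_algebraMap]
  | gen i => simp only [heckeRev_negGen]
  | add x y hx hy => rw [map_add, map_add, hx, hy]
  | mul x y hx hy => rw [heckeRev_mul, heckeRev_mul, hx, hy]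

theorem heckeIncl_negGen {m : ℕ} (i : Fin m) :
    heckeIncl m (negGen i) = negGen i.castSucc := by
  rw [negGen, heckeIncl, heckeLift_toHecke]
  simp [braidIncl, braidLift, sigma, negGen]

/-! ### The regular representation on functions on permutations. -/

/-- The free module on the permutations, as a module of functions. -/
abbrev PermMod (m : ℕ) : Type := Equiv.Perm (Fin (m + 1)) → ℤ[X]

/-- The action of `σ_i⁻¹` on functions on permutations. -/
noncomputable def permOp {m : ℕ} (i : Fin m) : Module.End ℤ[X] (PermMod m) where
  -- Right multiplication by g_i: ν_w g_i is ν_{w s_i} at an ascent of w, and ν_{w s_i} - z ν_w at a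
  -- descent, because g_i² = 1 - z g_i.
  toFun u w := u (w * adjSwap i) - if w i.succ < w i.castSucc then X * u w else 0
  map_add' u v := by
    ext1 w; simp only [Pi.add_apply]; split_ifs <;> ring
  map_smul' c u := by
    ext1 w; simp only [Pi.smul_apply, smul_eq_mul, RingHom.id_apply]; split_ifs <;> ring

theorem permOp_apply {m : ℕ} (i : Fin m) (u : PermMod m) (w : Equiv.Perm (Fin (m + 1))) :
    permOp i u w =
      u (w * adjSwap i) - if w i.succ < w i.castSucc then X * u w else 0 := rfl

theorem adjSwap_mul_self {m : ℕ} (i : Fin m) : adjSwap i * adjSwap i = 1 :=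
  Equiv.swap_mul_self _ _

theorem adjSwap_castSucc {m : ℕ} (i : Fin m) : adjSwap i i.castSucc = i.succ :=
  Equiv.swap_apply_left _ _

theorem adjSwap_succ {m : ℕ} (i : Fin m) : adjSwap i i.succ = i.castSucc :=
  Equiv.swap_apply_right _ _

theorem adjSwap_far {m : ℕ} (i j : Fin m) (h : i.val + 2 ≤ j.val) :
    adjSwap i * adjSwap j = adjSwap j * adjSwap i := by
  refine Equiv.Perm.Disjoint.commute ?_
  refine Equiv.Perm.disjoint_swap_swap ?_
  simp [Fin.ext_iff]; omega

theorem adjSwap_near {m : ℕ} (i j : Fin m) (h : i.val + 1 = j.val) :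
    adjSwap i * adjSwap j * adjSwap i = adjSwap j * adjSwap i * adjSwap j := by
  have e : j.castSucc = i.succ := by ext; simp [← h]
  have h1 : i.castSucc ≠ i.succ := by simp [Fin.ext_iff]
  have h2 : i.castSucc ≠ j.succ := by simp [Fin.ext_iff]; omega
  have h3 : i.succ ≠ j.succ := by simp [Fin.ext_iff]; omega
  ext x
  simp only [adjSwap, e, Equiv.Perm.mul_apply, Equiv.swap_apply_def]
  congr 1
  split_ifs <;> simp_all

theorem apply_succ_lt_or {m : ℕ} (w : Equiv.Perm (Fin (m + 1))) (i : Fin m) :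
    w i.succ < w i.castSucc ∨ w i.castSucc < w i.succ :=
  lt_or_gt_of_ne fun h => by simpa [Fin.ext_iff] using w.injective h

theorem permOp_mul_self {m : ℕ} (i : Fin m) :
    permOp i * permOp i = 1 - (X : ℤ[X]) • permOp i := by
  refine LinearMap.ext fun u => funext fun w => ?_
  simp only [Module.End.mul_apply, LinearMap.sub_apply, Module.End.one_apply,
    LinearMap.smul_apply, Pi.sub_apply, Pi.smul_apply, permOp_apply, mul_assoc,
    adjSwap_mul_self, mul_one, smul_eq_mul, Equiv.Perm.mul_apply, adjSwap_castSucc, adjSwap_succ]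
  rcases apply_succ_lt_or w i with h | h
  · simp only [h, h.not_gt, if_true, if_false]; ring
  · simp only [h, h.not_gt, if_true, if_false]; ring

theorem permOp_far {m : ℕ} (i j : Fin m) (h : i.val + 2 ≤ j.val) :
    permOp i * permOp j = permOp j * permOp i := by
  have e1 : adjSwap i j.succ = j.succ := by
    apply Equiv.swap_apply_of_ne_of_ne <;> simp [Fin.ext_iff] <;> omega
  have e2 : adjSwap i j.castSucc = j.castSucc := by
    apply Equiv.swap_apply_of_ne_of_ne <;> simp [Fin.ext_iff] <;> omega
  have e3 : adjSwap j i.succ = i.succ := by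
    apply Equiv.swap_apply_of_ne_of_ne <;> simp [Fin.ext_iff] <;> omega
  have e4 : adjSwap j i.castSucc = i.castSucc := by
    apply Equiv.swap_apply_of_ne_of_ne <;> simp [Fin.ext_iff] <;> omega
  refine LinearMap.ext fun u => funext fun w => ?_
  simp only [Module.End.mul_apply, permOp_apply, mul_assoc, adjSwap_far i j h,
    Equiv.Perm.mul_apply, e1, e2, e3, e4]
  split_ifs <;> ring

theorem permOp_near {m : ℕ} (i j : Fin m) (h : i.val + 1 = j.val) :
    permOp i * permOp j * permOp i = permOp j * permOp i * permOp j := by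
  have e : j.castSucc = i.succ := by ext; simp [← h]
  have e1 : adjSwap i j.succ = j.succ := by
    apply Equiv.swap_apply_of_ne_of_ne <;> simp [Fin.ext_iff] <;> omega
  have e2 : adjSwap j i.castSucc = i.castSucc := by
    apply Equiv.swap_apply_of_ne_of_ne <;> simp [Fin.ext_iff] <;> omega
  have e3 : adjSwap j i.succ = j.succ := by rw [← e, adjSwap_castSucc]
  have e4 : adjSwap j j.succ = i.succ := by rw [← e, adjSwap_succ]
  have hs := adjSwap_near i j h
  rw [mul_assoc, mul_assoc] at hs
  refine LinearMap.ext fun u => funext fun w => ?_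
  simp only [Module.End.mul_apply, permOp_apply, mul_assoc, adjSwap_mul_self, mul_one, hs,
    Equiv.Perm.mul_apply, e, e1, e2, e3, e4, adjSwap_succ, adjSwap_castSucc]
  have hne : w i.castSucc < w j.succ ∨ w j.succ < w i.castSucc :=
    lt_or_gt_of_ne fun h' => by
      have := Fin.ext_iff.1 (w.injective h')
      simp only [Fin.val_castSucc, Fin.val_succ] at this
      omega
  -- Only the relative order of the values of w at three consecutive positions matters; `omega`
  -- discards the two cyclic patterns.
  rcases apply_succ_lt_or w i with ha | ha <;> rcases apply_succ_lt_or w j with hb | hb <;>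
    rw [e] at hb <;> rcases hne with hc | hc <;>
    first
    | (exfalso; omega)
    | (simp only [ha, hb, hc, ha.not_gt, hb.not_gt, hc.not_gt, if_true, if_false] <;> ring)

/-- `permOp i` as an invertible operator. -/
noncomputable def permUnit {m : ℕ} (i : Fin m) : (Module.End ℤ[X] (PermMod m))ˣ where
  val := permOp i
  inv := permOp i + (X : ℤ[X]) • 1
  val_inv := by
    rw [mul_add, permOp_mul_self, mul_smul_comm, mul_one]; abel
  inv_val := by
    rw [add_mul, permOp_mul_self, smul_mul_assoc, one_mul]; abel

/-- The regular representation of the Hecke algebra. -/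
noncomputable def permRep (m : ℕ) : Hecke m →ₐ[ℤ[X]] Module.End ℤ[X] (PermMod m) :=
  -- The inverse appears because `permOp` models σ_i⁻¹, while `braidLift` asks for the image of σ_i.
  heckeLift ((Units.coeHom _).comp (braidLift (fun i => (permUnit i)⁻¹)
    (fun i j h => by
      rw [← mul_inv_rev, ← mul_inv_rev, inv_inj]
      exact Units.ext (permOp_far i j h).symm)
    (fun i j h => by
      simp only [← mul_inv_rev, inv_inj, ← mul_assoc]
      exact Units.ext (permOp_near i j h)))) (fun i => by
    simp only [MonoidHom.comp_apply, map_inv, Units.coeHom_apply]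
    simp [braidLift, sigma, permUnit, Algebra.algebraMap_eq_smul_one])

theorem permRep_negGen {m : ℕ} (i : Fin m) : permRep m (negGen i) = permOp i := by
  rw [negGen, permRep, heckeLift_toHecke]
  simp [braidLift, sigma, permUnit]

open Matrix in
-- The matrix is symmetric: the involution w ↦ w s_i plus a diagonal part.
theorem permOp_dotProduct {m : ℕ} (i : Fin m) (u v : PermMod m) :
    permOp i u ⬝ᵥ v = u ⬝ᵥ permOp i v := by
  simp only [dotProduct, permOp_apply, sub_mul, mul_sub, Finset.sum_sub_distrib]
  congr 1
  · refine Fintype.sum_equiv (Equiv.mulRight (adjSwap i)) _ _ fun w => ?_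
    simp [mul_assoc, adjSwap_mul_self]
  · refine Finset.sum_congr rfl fun w _ => ?_
    split_ifs <;> ring

open Matrix in
theorem permRep_dotProduct {m : ℕ} (x : Hecke m) (u v : PermMod m) :
    permRep m x u ⬝ᵥ v = u ⬝ᵥ permRep m (heckeRev m x) v := by
  induction x using Hecke.induction generalizing u v with
  | scalar r =>
    simp [heckeRev_algebraMap, AlgHom.commutes, Module.algebraMap_end_apply]
  | gen i => rw [heckeRev_negGen, permRep_negGen, permOp_dotProduct]
  | add x y hx hy =>
    simp only [map_add, LinearMap.add_apply, add_dotProduct, dotProduct_add, hx, hy]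
  | mul x y hx hy =>
    simp only [heckeRev_mul, map_mul, Module.End.mul_apply, hx, hy]

/-! ### Coordinates and reduced words. -/

/-- The coordinates of an element of the Hecke algebra in the negative permutation braids. -/
noncomputable def coords (m : ℕ) : Hecke m →ₗ[ℤ[X]] PermMod m :=
  LinearMap.applyₗ (Pi.single 1 1) ∘ₗ (permRep m).toLinearMap ∘ₗ heckeRev m

theorem coords_apply {m : ℕ} (x : Hecke m) :
    coords m x = permRep m (heckeRev m x) (Pi.single 1 1) := rfl

/-- The reversal in `coords` is there for this: it turns the left action `permRep` into right
multiplication. -/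
theorem coords_mul_negGen {m : ℕ} (x : Hecke m) (i : Fin m) :
    coords m (x * negGen i) = permOp i (coords m x) := by
  rw [coords_apply, heckeRev_mul, map_mul, heckeRev_negGen, permRep_negGen]; rfl

theorem coords_one (m : ℕ) : coords m 1 = Pi.single 1 1 := by
  rw [coords_apply, heckeRev_one, map_one]; rfl

theorem permOp_single {m : ℕ} (i : Fin m) (π : Equiv.Perm (Fin (m + 1)))
    (h : π i.castSucc < π i.succ) :
    permOp i (Pi.single π 1) = Pi.single (π * adjSwap i) 1 := by
  ext1 w
  rw [permOp_apply]
  have h1 : w * adjSwap i = π ↔ w = π * adjSwap i := by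
    constructor <;> rintro rfl <;> simp [mul_assoc, adjSwap_mul_self]
  have h2 : (if w i.succ < w i.castSucc then X * (Pi.single π 1 : PermMod m) w else 0) = 0 := by
    split_ifs with hw
    · rw [Pi.single_eq_of_ne, mul_zero]
      rintro rfl
      exact hw.not_gt h
    · rfl
  rw [h2, sub_zero]
  simp only [Pi.single_apply, h1]

/-- The product of the `σ_i⁻¹` along a word. -/
noncomputable def negWord {m : ℕ} (l : List (Fin m)) : Hecke m := (l.map negGen).prod

theorem card_inversions_mul_adjSwap {m : ℕ} (π : Equiv.Perm (Fin (m + 1))) (i : Fin m)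
    (h : π i.castSucc < π i.succ) :
    (inversions (π * adjSwap i)).card = (inversions π).card + 1 := by
  have := inversions_mul_adjSwap (π * adjSwap i) i (by
    simpa [adjSwap_succ, adjSwap_castSucc] using h)
  rw [mul_assoc, adjSwap_mul_self, mul_one] at this
  exact this.symm

theorem card_inversions_one (m : ℕ) :
    (inversions (1 : Equiv.Perm (Fin (m + 1)))).card = 0 := by
  rw [Finset.card_eq_zero, Finset.eq_empty_iff_forall_notMem]
  rintro ⟨a, b⟩ h
  rw [mem_inversions] at h
  exact h.1.not_gt h.2

theorem card_inversions_prod_le {m : ℕ} (l : List (Fin m)) :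
    (inversions (l.map adjSwap).prod).card ≤ l.length := by
  induction l using List.reverseRecOn with
  | nil => simp [card_inversions_one]
  | append_singleton t i ih =>
    rw [List.map_append, List.prod_append, List.length_append]
    simp only [List.map_cons, List.map_nil, List.prod_singleton, List.length_singleton]
    rcases apply_succ_lt_or (t.map adjSwap).prod i with h | h
    · have := inversions_mul_adjSwap _ i h; omega
    · have := card_inversions_mul_adjSwap _ i h; omega

/-- A prefix of a reduced word is reduced, so every letter meets an ascent, where `permOp` just
moves the delta function. Since any reduced word is allowed, the choice made in `negPermBraid` is
harmless. -/
theorem coords_negWord {m : ℕ} (l : List (Fin m)) (π : Equiv.Perm (Fin (m + 1)))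
    (h : IsReducedWord π l) : coords m (negWord l) = Pi.single π 1 := by
  induction l using List.reverseRecOn generalizing π with
  | nil =>
    obtain ⟨rfl, -⟩ := h
    simp [negWord, coords_one]
  | append_singleton t i ih =>
    obtain ⟨rfl, hl⟩ := h
    have hle := card_inversions_prod_le t
    rw [List.map_append, List.prod_append] at hl ⊢
    simp only [List.map_cons, List.map_nil, List.prod_singleton, List.length_append,
      List.length_singleton] at hl ⊢
    have hw : negWord (t ++ [i]) = negWord t * negGen i := by simp [negWord]
    rcases apply_succ_lt_or (t.map adjSwap).prod i with hi | hi
    -- At a descent the whole word would have fewer inversions than letters.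
    · have := inversions_mul_adjSwap _ i hi; omega
    · have := card_inversions_mul_adjSwap _ i hi
      rw [hw, coords_mul_negGen, ih _ ⟨rfl, by omega⟩, permOp_single _ _ hi]

theorem toHecke_negPermBraid {m : ℕ} (π : Equiv.Perm (Fin (m + 1))) :
    ∃ l, IsReducedWord π l ∧ toHecke m (negPermBraid π) = negWord l := by
  refine ⟨_, (exists_isReducedWord π).choose_spec, ?_⟩
  rw [negPermBraid, map_list_prod, List.map_map, negWord]
  rfl

theorem coords_negPermBraid {m : ℕ} (π : Equiv.Perm (Fin (m + 1))) :
    coords m (toHecke m (negPermBraid π)) = Pi.single π 1 := by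
  obtain ⟨l, hl, e⟩ := toHecke_negPermBraid π
  rw [e, coords_negWord l π hl]

theorem heckeRev_negWord {m : ℕ} (l : List (Fin m)) :
    heckeRev m (negWord l) = negWord l.reverse := by
  induction l with
  | nil => exact heckeRev_one m
  | cons i t ih =>
    have h1 : negWord (i :: t) = negGen i * negWord t := by simp [negWord]
    have h2 : negWord (i :: t).reverse = negWord t.reverse * negGen i := by simp [negWord]
    rw [h1, h2, heckeRev_mul, ih, heckeRev_negGen]

theorem card_inversions_inv {m : ℕ} (π : Equiv.Perm (Fin (m + 1))) :
    (inversions π⁻¹).card = (inversions π).card := by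
  refine Finset.card_bij' (fun p _ => (π⁻¹ p.2, π⁻¹ p.1)) (fun p _ => (π p.2, π p.1)) ?_ ?_ ?_ ?_
  · rintro ⟨a, b⟩ h
    simp only [mem_inversions] at h ⊢
    simpa using ⟨h.2, h.1⟩
  · rintro ⟨a, b⟩ h
    simp only [mem_inversions] at h ⊢
    simpa using ⟨h.2, h.1⟩
  · rintro ⟨a, b⟩ _; simp
  · rintro ⟨a, b⟩ _; simp

theorem IsReducedWord.reverse {m : ℕ} {π : Equiv.Perm (Fin (m + 1))} {l : List (Fin m)}
    (h : IsReducedWord π l) : IsReducedWord π⁻¹ l.reverse := by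
  obtain ⟨rfl, hl⟩ := h
  refine ⟨?_, by rw [card_inversions_inv, List.length_reverse, hl]⟩
  rw [List.prod_inv_reverse, List.map_map, List.map_reverse]
  congr 3

theorem coords_heckeRev_negPermBraid {m : ℕ} (π : Equiv.Perm (Fin (m + 1))) :
    coords m (heckeRev m (toHecke m (negPermBraid π))) = Pi.single π⁻¹ 1 := by
  obtain ⟨l, hl, e⟩ := toHecke_negPermBraid π
  rw [e, heckeRev_negWord, coords_negWord _ _ hl.reverse]

/-! ### The canonical trace as a dot product. -/

/-- The canonical trace: the coefficient of the trivial braid. -/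
noncomputable def tau (m : ℕ) : Hecke m →ₗ[ℤ[X]] ℤ[X] := LinearMap.proj 1 ∘ₗ coords m

theorem tau_apply {m : ℕ} (x : Hecke m) : tau m x = coords m x 1 := rfl

open Matrix in
-- Pair with δ_1 and move the operator of y to the other side by adjunction; what remains is the two
-- coordinate vectors.
theorem tau_mul_heckeRev {m : ℕ} (x y : Hecke m) :
    tau m (x * heckeRev m y) = coords m x ⬝ᵥ coords m y := by
  have h : tau m (x * heckeRev m y) = coords m (x * heckeRev m y) ⬝ᵥ Pi.single 1 1 := by
    rw [dotProduct_single, mul_one, tau_apply]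
  rw [h, coords_apply, heckeRev_mul, map_mul, Module.End.mul_apply, permRep_dotProduct,
    heckeRev_heckeRev]
  rfl

/-! ### Spanning by n! elements. -/

theorem Hecke.exists_algebraMap (x : Hecke 0) : ∃ r, x = algebraMap ℤ[X] _ r := by
  induction x using Hecke.induction with
  | scalar r => exact ⟨r, rfl⟩
  | gen i => exact i.elim0
  | add x y hx hy =>
    obtain ⟨a, rfl⟩ := hx
    obtain ⟨b, rfl⟩ := hy
    exact ⟨a + b, (map_add _ _ _).symm⟩
  | mul x y hx hy =>
    obtain ⟨a, rfl⟩ := hx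
    obtain ⟨b, rfl⟩ := hy
    exact ⟨a * b, (map_mul _ _ _).symm⟩

/-- The inverse of the last generator. -/
noncomputable def lastGen (m : ℕ) : Hecke (m + 1) := negGen (Fin.last m)

theorem lastGen_mul_self (m : ℕ) :
    lastGen m * lastGen m = 1 - (X : ℤ[X]) • lastGen m := negGen_mul_self _

theorem lastGen_near (m : ℕ) :
    lastGen (m + 1) * heckeIncl (m + 1) (lastGen m) * lastGen (m + 1) =
      heckeIncl (m + 1) (lastGen m) * lastGen (m + 1) * heckeIncl (m + 1) (lastGen m) := by
  rw [lastGen, lastGen, heckeIncl_negGen]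
  exact (negGen_near _ _ (by simp)).symm

theorem lastGen_far (m : ℕ) (c : Hecke m) :
    Commute (lastGen (m + 1)) (heckeIncl (m + 1) (heckeIncl m c)) := by
  induction c using Hecke.induction with
  | scalar r => rw [AlgHom.commutes, AlgHom.commutes]; exact (Algebra.commutes _ _).symm
  | gen i =>
    rw [heckeIncl_negGen, heckeIncl_negGen]
    exact (negGen_far _ _ (by simp)).symm
  | add x y hx hy => rw [map_add, map_add]; exact hx.add_right hy
  | mul x y hx hy => rw [map_mul, map_mul]; exact hx.mul_right hy

/-- The span of the elements `a * σ_m⁻¹ * b`, where `a` and `b` do not involve the last strand. -/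
noncomputable def twoSided (m : ℕ) : Submodule ℤ[X] (Hecke (m + 1)) :=
  Submodule.span ℤ[X] {x | ∃ a b, x = heckeIncl m a * lastGen m * heckeIncl m b}

theorem mul_mem_twoSided {m : ℕ} {x : Hecke (m + 1)} (hx : x ∈ twoSided m) (a b : Hecke m) :
    heckeIncl m a * x * heckeIncl m b ∈ twoSided m := by
  induction hx using Submodule.span_induction with
  | mem x hx =>
    obtain ⟨c, d, rfl⟩ := hx
    refine Submodule.subset_span ⟨a * c, d * b, ?_⟩
    simp only [map_mul, mul_assoc]
  | zero => simp
  | add x y _ _ hx hy => rw [mul_add, add_mul]; exact add_mem hx hy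
  | smul r x _ hx => rw [mul_smul_comm, smul_mul_assoc]; exact Submodule.smul_mem _ r hx

theorem lastGen_mem_twoSided (m : ℕ) : lastGen m ∈ twoSided m :=
  Submodule.subset_span ⟨1, 1, by simp⟩

theorem lastGen_mul_incl_mul_lastGen_mem {m : ℕ} {x : Hecke (m + 1)} (hx : x ∈ twoSided m) :
    lastGen (m + 1) * heckeIncl (m + 1) x * lastGen (m + 1) ∈ twoSided (m + 1) := by
  induction hx using Submodule.span_induction with
  | mem x hx =>
    obtain ⟨c, d, rfl⟩ := hx
    refine Submodule.subset_span
      ⟨heckeIncl m c * lastGen m, lastGen m * heckeIncl m d, ?_⟩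
    have hc := (lastGen_far m c).eq
    have hd := (lastGen_far m d).eq
    simp only [map_mul]
    calc _ = lastGen (m + 1) * heckeIncl (m + 1) (heckeIncl m c) *
          heckeIncl (m + 1) (lastGen m) *
          (heckeIncl (m + 1) (heckeIncl m d) * lastGen (m + 1)) := by simp only [mul_assoc]
      _ = heckeIncl (m + 1) (heckeIncl m c) * (lastGen (m + 1) * heckeIncl (m + 1) (lastGen m) *
          lastGen (m + 1)) * heckeIncl (m + 1) (heckeIncl m d) := by
        rw [hc, ← hd]; simp only [mul_assoc]
      _ = _ := by rw [lastGen_near]; simp only [mul_assoc]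
  | zero => simp
  | add x y _ _ hx hy => rw [map_add, mul_add, add_mul]; exact add_mem hx hy
  | smul r x _ hx =>
    rw [map_smul, mul_smul_comm, smul_mul_assoc]; exact Submodule.smul_mem _ r hx

/-- It suffices that the sum is stable under right multiplication by generators, and the only
critical product is g b g. Decompose b inductively: a part from one strand fewer commutes with g and
leaves g², and a two-sided part is handled by the braid relation. -/
theorem range_incl_sup_twoSided (m : ℕ) :
    LinearMap.range (heckeIncl m).toLinearMap ⊔ twoSided m = ⊤ := by
  induction m using Nat.strong_induction_on with | _ m ih =>
  set N := LinearMap.range (heckeIncl m).toLinearMap ⊔ twoSided m with hN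
  have incl_mem : ∀ a, heckeIncl m a ∈ N := fun a => Submodule.mem_sup_left ⟨a, rfl⟩
  have two_mem : ∀ x ∈ twoSided m, x ∈ N := fun x hx => Submodule.mem_sup_right hx
  have sq_mem : lastGen m * lastGen m ∈ N := by
    rw [lastGen_mul_self, ← map_one (heckeIncl m)]
    exact sub_mem (incl_mem 1) (Submodule.smul_mem _ _ (two_mem _ (lastGen_mem_twoSided m)))
  have bimod : ∀ a b x, x ∈ N → heckeIncl m a * x * heckeIncl m b ∈ N := by
    intro a b x hx
    obtain ⟨_, ⟨c, rfl⟩, y, hy, rfl⟩ := Submodule.mem_sup.1 hx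
    rw [mul_add, add_mul]
    refine add_mem ?_ (two_mem _ (mul_mem_twoSided hy a b))
    simpa using incl_mem (a * c * b)
  have mid : ∀ b, lastGen m * heckeIncl m b * lastGen m ∈ N := by
    intro b
    rcases m with _ | m
    · obtain ⟨r, rfl⟩ := b.exists_algebraMap
      rw [AlgHom.commutes, ← Algebra.commutes, mul_assoc, ← Algebra.smul_def]
      exact Submodule.smul_mem _ _ sq_mem
    · have hb : b ∈ LinearMap.range (heckeIncl m).toLinearMap ⊔ twoSided m := by
        rw [ih m (by omega)]; trivial
      obtain ⟨_, ⟨c, rfl⟩, y, hy, rfl⟩ := Submodule.mem_sup.1 hb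
      rw [map_add, mul_add, add_mul]
      refine add_mem ?_ (two_mem _ (lastGen_mul_incl_mul_lastGen_mem hy))
      have := bimod (heckeIncl m c) 1 _ sq_mem
      rw [map_one, mul_one, ← mul_assoc, ← (lastGen_far m c).eq] at this
      exact this
  have right : ∀ x, ∀ y ∈ N, y * x ∈ N := by
    intro x
    induction x using Hecke.induction with
    | scalar r =>
      intro y hy
      rw [← Algebra.commutes, ← Algebra.smul_def]
      exact Submodule.smul_mem _ _ hy
    | gen j =>
      intro y hy
      induction j using Fin.lastCases with
      | last =>
        obtain ⟨_, ⟨c, rfl⟩, t, ht, rfl⟩ := Submodule.mem_sup.1 hy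
        rw [add_mul]
        refine add_mem (two_mem _ (Submodule.subset_span ⟨c, 1, by simp [lastGen]⟩)) ?_
        clear hy
        induction ht using Submodule.span_induction with
        | mem x hx =>
          obtain ⟨a, b, rfl⟩ := hx
          simpa [mul_assoc, lastGen] using bimod a 1 _ (mid b)
        | zero => simp
        | add x y _ _ hx hy => rw [add_mul]; exact add_mem hx hy
        | smul r x _ hx => rw [smul_mul_assoc]; exact Submodule.smul_mem _ r hx
      | cast j =>
        rw [← heckeIncl_negGen]
        simpa using bimod 1 (negGen j) y hy
    | add a b ha hb => intro y hy; rw [mul_add]; exact add_mem (ha y hy) (hb y hy)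
    | mul a b ha hb => intro y hy; rw [← mul_assoc]; exact hb _ (ha y hy)
  rw [eq_top_iff]
  rintro x -
  simpa using right x _ (incl_mem 1)

theorem Hecke.induction_last {m : ℕ} {P : Hecke (m + 1) → Prop}
    (incl : ∀ a, P (heckeIncl m a))
    (mid : ∀ a b, P (heckeIncl m a * lastGen m * heckeIncl m b))
    (add : ∀ x y, P x → P y → P (x + y)) (x : Hecke (m + 1)) : P x := by
  have hx : x ∈ LinearMap.range (heckeIncl m).toLinearMap ⊔ twoSided m := by
    rw [range_incl_sup_twoSided m]; trivial
  obtain ⟨_, ⟨c, rfl⟩, y, hy, rfl⟩ := Submodule.mem_sup.1 hx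
  refine add _ _ (incl c) ?_
  clear hx
  have hz : P 0 := by simpa using incl 0
  -- P is only assumed additive, so the scalar is carried along and absorbed into the left factor a.
  have hy' : ∀ r : ℤ[X], P (r • y) := by
    induction hy using Submodule.span_induction with
    | mem x hx =>
      obtain ⟨a, b, rfl⟩ := hx
      intro r
      simpa using mid (r • a) b
    | zero => simpa using hz
    | add x y _ _ hx hy => intro r; rw [smul_add]; exact add _ _ (hx r) (hy r)
    | smul s x _ hx => intro r; rw [smul_smul]; exact hx _
  simpa using hy' 1

/-- The analogue of the cosets of S_{m+1} in S_{m+2}. The generators are 1, g_m, g_m g_{m-1}, and so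
on; expanding b over the previous ones, the coefficients commute with the last g and pass to the
left. -/
theorem exists_coset_generators (m : ℕ) : ∃ r : Fin (m + 2) → Hecke (m + 1),
    ∀ x, ∃ a : Fin (m + 2) → Hecke m, x = ∑ k, heckeIncl m (a k) * r k := by
  have key : ∀ (m : ℕ) (r : Fin (m + 2) → Hecke (m + 1)),
      (∀ a : Hecke m, ∃ c : Fin (m + 2) → Hecke m,
        heckeIncl m a = ∑ k, heckeIncl m (c k) * r k) →
      (∀ a b : Hecke m, ∃ c : Fin (m + 2) → Hecke m,
        heckeIncl m a * lastGen m * heckeIncl m b = ∑ k, heckeIncl m (c k) * r k) →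
      ∀ x, ∃ a : Fin (m + 2) → Hecke m, x = ∑ k, heckeIncl m (a k) * r k := by
    intro m r h1 h2 x
    induction x using Hecke.induction_last with
    | incl a => exact h1 a
    | mid a b => exact h2 a b
    | add x y hx hy =>
      obtain ⟨c, rfl⟩ := hx
      obtain ⟨d, rfl⟩ := hy
      refine ⟨c + d, ?_⟩
      simp only [Pi.add_apply, map_add, add_mul, Finset.sum_add_distrib]
  induction m with
  | zero =>
    refine ⟨![1, lastGen 0], key 0 _ (fun a => ⟨![a, 0], by simp⟩) fun a b => ?_⟩
    obtain ⟨s, rfl⟩ := b.exists_algebraMap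
    refine ⟨![0, s • a], ?_⟩
    simp only [AlgHom.commutes, ← Algebra.commutes, ← Algebra.smul_def]
    simp
  | succ m ih =>
    obtain ⟨r, hr⟩ := ih
    refine ⟨Fin.cons 1 fun k => lastGen (m + 1) * heckeIncl (m + 1) (r k),
      key _ _ (fun a => ⟨Fin.cons a 0, by simp [Fin.sum_univ_succ (n := m + 2)]⟩) fun a b => ?_⟩
    obtain ⟨c, rfl⟩ := hr b
    refine ⟨Fin.cons 0 fun k => a * heckeIncl m (c k), ?_⟩
    rw [Fin.sum_univ_succ (n := m + 2)]
    simp only [Fin.cons_zero, Fin.cons_succ, map_zero, zero_mul, zero_add, map_sum, map_mul,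
      Finset.mul_sum]
    refine Finset.sum_congr rfl fun k _ => ?_
    have := (lastGen_far m (c k)).eq
    simp only [mul_assoc]
    rw [← mul_assoc (lastGen (m + 1)), this]
    simp only [mul_assoc]

open Nat in
theorem exists_spanning_family (m : ℕ) : ∃ (ι : Type) (_ : Fintype ι) (v : ι → Hecke m),
    Fintype.card ι = (m + 1)! ∧ Submodule.span ℤ[X] (Set.range v) = ⊤ := by
  induction m with
  | zero =>
    refine ⟨Unit, inferInstance, fun _ => 1, by simp, ?_⟩
    rw [eq_top_iff]
    rintro x -
    obtain ⟨r, rfl⟩ := x.exists_algebraMap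
    rw [Algebra.algebraMap_eq_smul_one]
    exact Submodule.smul_mem _ _ (Submodule.subset_span ⟨(), rfl⟩)
  | succ m ih =>
    obtain ⟨ι, _, v, hc, hv⟩ := ih
    obtain ⟨r, hr⟩ := exists_coset_generators m
    refine ⟨ι × Fin (m + 2), inferInstance, fun p => heckeIncl m (v p.1) * r p.2, ?_, ?_⟩
    · rw [Fintype.card_prod, hc, Fintype.card_fin, Nat.factorial_succ (m + 1), mul_comm]
    · rw [eq_top_iff]
      rintro x -
      obtain ⟨a, rfl⟩ := hr x
      refine sum_mem fun k _ => ?_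
      have ha : a k ∈ Submodule.span ℤ[X] (Set.range v) := by rw [hv]; trivial
      generalize a k = b at ha
      induction ha using Submodule.span_induction with
      | mem x hx =>
        obtain ⟨i, rfl⟩ := hx
        exact Submodule.subset_span ⟨(i, k), rfl⟩
      | zero => simp
      | add x y _ _ hx hy => rw [map_add, add_mul]; exact add_mem hx hy
      | smul s x _ hx => rw [map_smul, smul_mul_assoc]; exact Submodule.smul_mem _ s hx

/-! ### The basis and the trace property. -/

theorem coords_surjective (m : ℕ) : Function.Surjective (coords m) := by
  rw [← LinearMap.range_eq_top, eq_top_iff, ← (Pi.basisFun ℤ[X] _).span_eq, Submodule.span_le]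
  rintro _ ⟨π, rfl⟩
  exact ⟨toHecke m (negPermBraid π), by simp [coords_negPermBraid]⟩

/-- Composed with the surjection given by n! spanning elements, `coords` is a surjective
endomorphism of a finite free module, hence injective by the Orzech property. -/
theorem coords_bijective (m : ℕ) : Function.Bijective (coords m) := by
  refine ⟨?_, coords_surjective m⟩
  obtain ⟨ι, _, v, hc, hv⟩ := exists_spanning_family m
  have e : Equiv.Perm (Fin (m + 1)) ≃ ι := Fintype.equivOfCardEq (by
    rw [hc, Fintype.card_perm, Fintype.card_fin])
  have hf : Function.Surjective (Fintype.linearCombination ℤ[X] (v ∘ e)) := by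
    rw [← LinearMap.range_eq_top, Fintype.range_linearCombination, e.surjective.range_comp, hv]
  have hinj : Function.Injective (coords m ∘ₗ Fintype.linearCombination ℤ[X] (v ∘ e)) :=
    OrzechProperty.injective_of_surjective_endomorphism _ ((coords_surjective m).comp hf)
  intro x y hxy
  obtain ⟨a, rfl⟩ := hf x
  obtain ⟨b, rfl⟩ := hf y
  exact congrArg _ (hinj hxy)

/-- The basis of the Hecke algebra formed by the negative permutation braids. -/
noncomputable def negPermBasis (m : ℕ) :
    Module.Basis (Equiv.Perm (Fin (m + 1))) ℤ[X] (Hecke m) :=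
  .ofEquivFun (LinearEquiv.ofBijective (coords m) (coords_bijective m))

theorem negPermBasis_apply {m : ℕ} (π : Equiv.Perm (Fin (m + 1))) :
    negPermBasis m π = toHecke m (negPermBraid π) := by
  apply (coords_bijective m).1
  rw [coords_negPermBraid, negPermBasis, Module.Basis.coe_ofEquivFun]
  exact LinearEquiv.apply_symm_apply (LinearEquiv.ofBijective (coords m) (coords_bijective m)) _

theorem coords_heckeRev {m : ℕ} (x : Hecke m) (w : Equiv.Perm (Fin (m + 1))) :
    coords m (heckeRev m x) w = coords m x w⁻¹ := by
  have h : coords m ∘ₗ heckeRev m = LinearMap.funLeft ℤ[X] ℤ[X] (·⁻¹) ∘ₗ coords m := by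
    refine (negPermBasis m).ext fun π => ?_
    ext1 w
    simp only [LinearMap.comp_apply, negPermBasis_apply, coords_heckeRev_negPermBraid,
      coords_negPermBraid, LinearMap.funLeft_apply, Pi.single_apply, inv_eq_iff_eq_inv]
  exact congrFun (LinearMap.congr_fun h x) w

/-- Both sides are dot products of coordinates, matched by the substitution w ↦ w⁻¹. -/
theorem tau_mul_comm {m : ℕ} (x y : Hecke m) : tau m (x * y) = tau m (y * x) := by
  have h1 := tau_mul_heckeRev x (heckeRev m y)
  have h2 := tau_mul_heckeRev y (heckeRev m x)
  rw [heckeRev_heckeRev] at h1 h2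
  rw [h1, h2]
  refine Fintype.sum_equiv (Equiv.inv _) _ _ fun w => ?_
  rw [Equiv.inv_apply, coords_heckeRev, coords_heckeRev, inv_inv, mul_comm]

/-! ### Adding a strand. -/

/-- The extension of a permutation by a fixed last point. -/
noncomputable def extendPerm (m : ℕ) :
    Equiv.Perm (Fin (m + 1)) →* Equiv.Perm (Fin (m + 2)) :=
  Equiv.Perm.viaEmbeddingHom Fin.castSuccEmb

theorem extendPerm_castSucc {m : ℕ} (w : Equiv.Perm (Fin (m + 1))) (a : Fin (m + 1)) :
    extendPerm m w a.castSucc = (w a).castSucc :=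
  Equiv.Perm.viaEmbedding_apply w Fin.castSuccEmb a

theorem extendPerm_last {m : ℕ} (w : Equiv.Perm (Fin (m + 1))) :
    extendPerm m w (Fin.last _) = Fin.last _ :=
  Equiv.Perm.viaEmbedding_apply_of_notMem w Fin.castSuccEmb _ (by
    rintro ⟨a, ha⟩
    exact (Fin.castSucc_lt_last a).ne ha)

theorem extendPerm_adjSwap {m : ℕ} (i : Fin m) :
    extendPerm m (adjSwap i) = adjSwap i.castSucc := by
  ext x
  induction x using Fin.lastCases with
  | last =>
    rw [extendPerm_last, adjSwap, Equiv.swap_apply_of_ne_of_ne] <;>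
      simp [Fin.ext_iff] <;> omega
  | cast x =>
    rw [extendPerm_castSucc, adjSwap, adjSwap, Equiv.swap_apply_def, Equiv.swap_apply_def]
    simp only [← Fin.castSucc_succ, Fin.castSucc_inj]
    split_ifs <;> rfl

theorem coords_heckeIncl {m : ℕ} (x : Hecke m) :
    (∀ w, coords (m + 1) (heckeIncl m x) (extendPerm m w) = coords m x w) ∧
    ∀ w, w (Fin.last _) ≠ Fin.last _ → coords (m + 1) (heckeIncl m x) w = 0 := by
  -- Stated for every u that extends u' by zero, not only for δ_1, so that the claim composes under
  -- products.
  have key : ∀ (x : Hecke m) (u : PermMod (m + 1)) (u' : PermMod m),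
      (∀ w, u (extendPerm m w) = u' w) ∧ (∀ w, w (Fin.last _) ≠ Fin.last _ → u w = 0) →
      (∀ w, permRep (m + 1) (heckeIncl m x) u (extendPerm m w) = permRep m x u' w) ∧
        ∀ w, w (Fin.last _) ≠ Fin.last _ → permRep (m + 1) (heckeIncl m x) u w = 0 := by
    intro x
    induction x using Hecke.induction with
    | scalar r =>
      rintro u u' ⟨h1, h2⟩
      simp only [AlgHom.commutes, Module.algebraMap_end_apply, Pi.smul_apply]
      exact ⟨fun w => by rw [h1], fun w hw => by rw [h2 w hw, smul_zero]⟩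
    | gen i =>
      rintro u u' ⟨h1, h2⟩
      simp only [heckeIncl_negGen, permRep_negGen, permOp_apply]
      refine ⟨fun w => ?_, fun w hw => ?_⟩
      · rw [← extendPerm_adjSwap, ← map_mul, h1, h1, ← Fin.castSucc_succ, extendPerm_castSucc,
          extendPerm_castSucc]
        simp only [Fin.castSucc_lt_castSucc_iff]
      · rw [h2 w hw, h2, mul_zero, ite_self, sub_zero]
        rwa [Equiv.Perm.mul_apply, ← extendPerm_adjSwap, extendPerm_last]
    | add x y hx hy =>
      rintro u u' h
      simp only [map_add, LinearMap.add_apply, Pi.add_apply]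
      exact ⟨fun w => by rw [(hx u u' h).1, (hy u u' h).1],
        fun w hw => by rw [(hx u u' h).2 w hw, (hy u u' h).2 w hw, add_zero]⟩
    | mul x y hx hy =>
      rintro u u' h
      simp only [map_mul, Module.End.mul_apply]
      exact hx _ _ (hy u u' h)
  have hrev : heckeRev (m + 1) (heckeIncl m x) = heckeIncl m (heckeRev m x) := by
    induction x using Hecke.induction with
    | scalar r => simp only [heckeRev_algebraMap, AlgHom.commutes]
    | gen i => simp only [heckeIncl_negGen, heckeRev_negGen]
    | add x y hx hy => simp only [map_add, hx, hy]
    | mul x y hx hy => simp only [map_mul, heckeRev_mul, hx, hy]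
  rw [coords_apply, coords_apply, hrev]
  refine key _ _ _ ⟨fun w => ?_, fun w hw => ?_⟩
  · have : extendPerm m w = 1 ↔ w = 1 :=
      map_eq_one_iff _ (Equiv.Perm.viaEmbeddingHom_injective _)
    simp only [Pi.single_apply, this]
  · rw [Pi.single_eq_of_ne]
    rintro rfl
    exact hw rfl

theorem tau_heckeIncl {m : ℕ} (x : Hecke m) : tau (m + 1) (heckeIncl m x) = tau m x := by
  rw [tau_apply, tau_apply, ← (coords_heckeIncl x).1, map_one]

/-- The coefficient sought is that of the included element at the last transposition, which moves
the last point. -/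
theorem tau_heckeIncl_mul_lastGen {m : ℕ} (x : Hecke m) :
    tau (m + 1) (heckeIncl m x * lastGen m) = 0 := by
  have h1 : ¬ (1 : Equiv.Perm (Fin (m + 2))) (Fin.last m).succ <
      (1 : Equiv.Perm (Fin (m + 2))) (Fin.last m).castSucc := by
    simp [Fin.lt_def]
  rw [tau_apply, lastGen, coords_mul_negGen, permOp_apply, if_neg h1, one_mul, sub_zero]
  refine (coords_heckeIncl x).2 _ ?_
  rw [← Fin.succ_last, adjSwap_succ]
  simp [Fin.ext_iff]

theorem tau_eq_zero_of_mem_twoSided {m : ℕ} {x : Hecke (m + 1)} (hx : x ∈ twoSided m) :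
    tau (m + 1) x = 0 := by
  induction hx using Submodule.span_induction with
  | mem x hx =>
    obtain ⟨a, b, rfl⟩ := hx
    rw [tau_mul_comm, ← mul_assoc, ← map_mul, tau_heckeIncl_mul_lastGen]
  | zero => simp
  | add x y _ _ hx hy => rw [map_add, hx, hy, add_zero]
  | smul r x _ hx => rw [map_smul, hx, smul_zero]

/-! ### Jucys–Murphy elements. -/

/-- The Jucys–Murphy element of the last strand, up to normalisation. -/
noncomputable def jucysMurphy : ∀ m : ℕ, Hecke m
  | 0 => 0
  | m + 1 => lastGen m * heckeIncl m (jucysMurphy m) * lastGen m + lastGen m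

theorem jucysMurphy_succ (m : ℕ) : jucysMurphy (m + 1) =
    lastGen m * heckeIncl m (jucysMurphy m) * lastGen m + lastGen m := rfl

theorem jucysMurphy_mem_twoSided (m : ℕ) : jucysMurphy (m + 1) ∈ twoSided m := by
  induction m with
  | zero => simpa [jucysMurphy] using lastGen_mem_twoSided 0
  | succ m ih =>
    exact add_mem (lastGen_mul_incl_mul_lastGen_mem ih) (lastGen_mem_twoSided _)

theorem commute_of_incl_of_lastGen {m : ℕ} {y : Hecke (m + 1)}
    (hi : ∀ a, Commute y (heckeIncl m a)) (hg : Commute y (lastGen m)) (x : Hecke (m + 1)) :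
    Commute y x := by
  induction x using Hecke.induction_last with
  | incl a => exact hi a
  | mid a b => exact ((hi a).mul_right hg).mul_right (hi b)
  | add x y hx hy => exact hx.add_right hy

/-- The term g h J h g slides past h by the braid relation. The terms g h g and g do not commute
with h separately, but their defects cancel. -/
theorem braid_commute {R A : Type*} [CommRing R] [Ring A] [Algebra R A] (c : R) (g h J : A)
    (hh : h * h = 1 - c • h) (hgh : g * h * g = h * g * h)
    (hJ : Commute g J) : Commute (g * (h * J * h + h) * g + g) h := by
  have e1 : g * (h * J * h) * g * h = h * (g * (h * J * h) * g) := by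
    calc _ = g * h * J * (h * g * h) := by simp only [mul_assoc]
      _ = g * h * (J * g) * h * g := by rw [← hgh]; simp only [mul_assoc]
      _ = g * h * g * J * h * g := by rw [← hJ.eq]; simp only [mul_assoc]
      _ = _ := by rw [hgh]; simp only [mul_assoc]
  have e2 : g * h * g * h = h * g - c • (h * g * h) := by
    rw [hgh, mul_assoc (h * g), hh, mul_sub, mul_smul_comm, mul_one]
  have e3 : h * (g * h * g) = g * h - c • (h * g * h) := by
    rw [hgh, ← mul_assoc, ← mul_assoc, hh, sub_mul, sub_mul, smul_mul_assoc, smul_mul_assoc,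
      one_mul]
  rw [commute_iff_eq]
  simp only [mul_add, add_mul, e1, e2, e3]
  abel

/-- This and `commute_mul_twist` treat the sum and product of two consecutive Jucys–Murphy elements,
J and gJg + g: g commutes with these although not with each element. -/
theorem commute_add_twist {R A : Type*} [CommRing R] [Ring A] [Algebra R A] (c : R) (g J : A)
    (hg : g * g = 1 - c • g) : Commute g (J + (g * J * g + g)) := by
  have e1 : g * (g * J * g) = J * g - c • (g * J * g) := by
    rw [mul_assoc g J, ← mul_assoc, hg, sub_mul, smul_mul_assoc, one_mul]
  have e2 : g * J * g * g = g * J - c • (g * J * g) := by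
    rw [mul_assoc (g * J), hg, mul_sub, mul_smul_comm, mul_one]
  rw [commute_iff_eq, mul_add, mul_add, add_mul, add_mul, e1, e2]
  abel

theorem commute_mul_twist {R A : Type*} [CommRing R] [Ring A] [Algebra R A] (c : R) (g J : A)
    (hg : g * g = 1 - c • g) (hJ : Commute J (g * J * g + g)) :
    Commute g (J * (g * J * g + g)) := by
  have e1 : g * ((g * J * g + g) * J) = (J * g + 1) * J - c • ((g * J * g + g) * J) := by
    rw [← mul_assoc]
    have : g * (g * J * g + g) = (g * g) * (J * g + 1) := by
      simp only [mul_add, mul_one, mul_assoc]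
    rw [this, hg, sub_mul, one_mul, sub_mul, smul_mul_assoc, smul_mul_assoc]
    simp only [mul_add, mul_one, mul_assoc]
  have e2 : J * (g * J * g + g) * g = J * (g * J + 1) - c • (J * (g * J * g + g)) := by
    have : J * (g * J * g + g) * g = J * (g * J + 1) * (g * g) := by
      simp only [mul_add, add_mul, mul_one, mul_assoc]
    rw [this, hg, mul_sub, mul_one, mul_smul_comm]
    simp only [mul_add, add_mul, mul_one, mul_assoc]
  rw [commute_iff_eq, e2, hJ.eq, e1]
  simp only [mul_add, add_mul, mul_one, one_mul, mul_assoc]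

theorem jucysMurphy_commute (m : ℕ) (a : Hecke m) :
    Commute (jucysMurphy (m + 1)) (heckeIncl m a) := by
  induction m with
  | zero =>
    obtain ⟨r, rfl⟩ := a.exists_algebraMap
    rw [AlgHom.commutes]
    exact (Algebra.commutes _ _).symm
  | succ m ih =>
    suffices h : ∀ x, Commute (jucysMurphy (m + 2)) (heckeIncl (m + 1) x) from h a
    have hi : ∀ c, Commute (jucysMurphy (m + 2)) (heckeIncl (m + 1) (heckeIncl m c)) := by
      intro c
      have h1 := lastGen_far m c
      have h2 := (ih c).map (heckeIncl (m + 1))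
      rw [jucysMurphy_succ]
      exact ((h1.mul_left h2).mul_left h1).add_left h1
    have hg : Commute (jucysMurphy (m + 2)) (heckeIncl (m + 1) (lastGen m)) := by
      have hh := congrArg (heckeIncl (m + 1)) (lastGen_mul_self m)
      simp only [map_mul, map_sub, map_one, map_smul] at hh
      have := braid_commute (X : ℤ[X]) _ _ _ hh (lastGen_near m)
        (lastGen_far m (jucysMurphy m))
      rw [jucysMurphy_succ, jucysMurphy_succ m]
      simpa only [map_mul, map_add] using this
    intro x
    induction x using Hecke.induction_last with
    | incl a => exact hi a
    | mid a b => rw [map_mul, map_mul]; exact ((hi a).mul_right hg).mul_right (hi b)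
    | add x y hx hy => rw [map_add]; exact hx.add_right hy

/-! ### Central elements. -/

/-- The elementary symmetric polynomials in the Jucys–Murphy elements. -/
noncomputable def esymmJM : ∀ m : ℕ, ℕ → Hecke m
  | 0, 0 => 1
  | 0, _ + 1 => 0
  | m + 1, 0 => heckeIncl m (esymmJM m 0)
  | m + 1, k + 1 =>
    heckeIncl m (esymmJM m (k + 1)) + heckeIncl m (esymmJM m k) * jucysMurphy (m + 1)

theorem esymmJM_zero (m : ℕ) : esymmJM m 0 = 1 := by
  induction m with
  | zero => rfl
  | succ m ih => rw [esymmJM, ih, map_one]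

theorem esymmJM_eq_zero {m k : ℕ} (h : m < k) : esymmJM m k = 0 := by
  induction m generalizing k with
  | zero => obtain ⟨k, rfl⟩ := Nat.exists_eq_add_of_lt h; rw [zero_add, esymmJM]
  | succ m ih =>
    obtain ⟨k, rfl⟩ : ∃ l, k = l + 1 := ⟨k - 1, by omega⟩
    rw [esymmJM, ih (by omega), ih (by omega)]
    simp

theorem esymmJM_succ_succ (m k : ℕ) : esymmJM (m + 1) (k + 1) =
    heckeIncl m (esymmJM m (k + 1)) + heckeIncl m (esymmJM m k) * jucysMurphy (m + 1) := rfl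

theorem esymmJM_commute_incl {m : ℕ} (ih : ∀ k x, Commute (esymmJM m k) x) (k : ℕ)
    (a : Hecke m) : Commute (esymmJM (m + 1) k) (heckeIncl m a) := by
  rcases k with _ | k
  · exact (ih 0 a).map (heckeIncl m)
  · exact ((ih _ a).map (heckeIncl m)).add_left
      (((ih k a).map (heckeIncl m)).mul_left (jucysMurphy_commute m a))

theorem esymmJM_commute_lastGen (m k : ℕ) : Commute (esymmJM (m + 1) k) (lastGen m) := by
  rcases k with _ | k
  · rw [esymmJM_zero]; exact Commute.one_left _
  rw [esymmJM_succ_succ]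
  rcases m with _ | m
  · have h : ∀ k, Commute (heckeIncl 0 (esymmJM 0 k)) (lastGen 0) := by
      rintro (_ | k)
      · rw [esymmJM_zero, map_one]; exact Commute.one_left _
      · rw [esymmJM, map_zero]; exact Commute.zero_left _
    refine (h _).add_left ((h _).mul_left ?_)
    simp [jucysMurphy]
  · have hs := (commute_add_twist (X : ℤ[X]) _ (heckeIncl (m + 1) (jucysMurphy (m + 1)))
      (lastGen_mul_self (m + 1))).symm
    have hp := (commute_mul_twist (X : ℤ[X]) _ (heckeIncl (m + 1) (jucysMurphy (m + 1)))
      (lastGen_mul_self (m + 1)) (jucysMurphy_commute (m + 1) (jucysMurphy (m + 1))).symm).symm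
    rw [← jucysMurphy_succ] at hs hp
    have hi := fun k => (lastGen_far m (esymmJM m k)).symm
    rcases k with _ | k
    · rw [esymmJM_zero, map_one, one_mul, esymmJM_succ_succ, esymmJM_zero, map_one, one_mul,
        map_add, add_assoc (heckeIncl _ _)]
      exact (hi 1).add_left hs
    -- Isolate the last two Jucys–Murphy elements: they enter only through their sum and product,
    -- and the coefficients are far from g.
    · have e : heckeIncl (m + 1) (esymmJM (m + 1) (k + 1 + 1)) +
          heckeIncl (m + 1) (esymmJM (m + 1) (k + 1)) * jucysMurphy (m + 1 + 1) =
          heckeIncl (m + 1) (heckeIncl m (esymmJM m (k + 2))) +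
          heckeIncl (m + 1) (heckeIncl m (esymmJM m (k + 1))) *
            (heckeIncl (m + 1) (jucysMurphy (m + 1)) + jucysMurphy (m + 1 + 1)) +
          heckeIncl (m + 1) (heckeIncl m (esymmJM m k)) *
            (heckeIncl (m + 1) (jucysMurphy (m + 1)) * jucysMurphy (m + 1 + 1)) := by
        simp only [esymmJM_succ_succ, map_add, map_mul, mul_add, add_mul, mul_assoc]
        abel
      rw [e]
      exact ((hi _).add_left ((hi _).mul_left hs)).add_left ((hi _).mul_left hp)

theorem esymmJM_commute (m k : ℕ) (x : Hecke m) : Commute (esymmJM m k) x := by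
  induction m generalizing k with
  | zero =>
    obtain ⟨r, rfl⟩ := x.exists_algebraMap
    exact (Algebra.commutes _ _).symm
  | succ m ih =>
    exact commute_of_incl_of_lastGen (esymmJM_commute_incl (fun k x => ih k x) k)
      (esymmJM_commute_lastGen m k) x

/-! ### Ocneanu's trace: existence and uniqueness. -/

/-- Ocneanu's trace, as a combination of the traces `x ↦ tau (e_k * x)`. -/
noncomputable def ocneanu (m : ℕ) : Hecke m →ₗ[ℤ[X]] ℤ[X][X] where
  toFun x := ∑ k ∈ Finset.range (m + 1), (X - C X) ^ k * C (tau m (esymmJM m k * x))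
  map_add' x y := by
    simp only [mul_add, map_add, Finset.sum_add_distrib]
  map_smul' r x := by
    simp only [mul_smul_comm, map_smul, smul_eq_mul, map_mul, smul_eq_C_mul, RingHom.id_apply,
      Finset.mul_sum]
    exact Finset.sum_congr rfl fun k _ => by ring

theorem ocneanu_apply (m : ℕ) (x : Hecke m) : ocneanu m x =
    ∑ k ∈ Finset.range (m + 1), (X - C X) ^ k * C (tau m (esymmJM m k * x)) := rfl

theorem eval_ocneanu {m : ℕ} (x : Hecke m) : (ocneanu m x).eval X = tau m x := by
  rw [ocneanu_apply, eval_finsetSum, Finset.sum_range_succ']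
  simp [esymmJM_zero]

theorem ocneanu_mul_comm {m : ℕ} (x y : Hecke m) : ocneanu m (x * y) = ocneanu m (y * x) := by
  simp only [ocneanu_apply]
  refine Finset.sum_congr rfl fun k _ => ?_
  rw [← mul_assoc, (esymmJM_commute m k x).eq, mul_assoc, tau_mul_comm, mul_assoc]

theorem tau_incl_mul_jucysMurphy {m : ℕ} (a : Hecke m) :
    tau (m + 1) (heckeIncl m a * jucysMurphy (m + 1)) = 0 := by
  refine tau_eq_zero_of_mem_twoSided ?_
  simpa using mul_mem_twoSided (jucysMurphy_mem_twoSided m) a 1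

/-- With J' the preceding element, J g = g J' + 1 - z J; the first and last terms lie in the
two-sided span, where `tau` vanishes. -/
theorem tau_incl_mul_jucysMurphy_mul_lastGen {m : ℕ} (b : Hecke m) :
    tau (m + 1) (heckeIncl m b * (jucysMurphy (m + 1) * lastGen m)) = tau m b := by
  have e : jucysMurphy (m + 1) * lastGen m =
      lastGen m * heckeIncl m (jucysMurphy m) + 1 - (X : ℤ[X]) • jucysMurphy (m + 1) := by
    have : jucysMurphy (m + 1) * lastGen m =
        (lastGen m * heckeIncl m (jucysMurphy m) + 1) * (lastGen m * lastGen m) := by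
      rw [jucysMurphy_succ]; simp only [add_mul, one_mul, mul_assoc]
    rw [this, lastGen_mul_self, mul_sub, mul_one, mul_smul_comm, jucysMurphy_succ]
    simp only [add_mul, one_mul]
  have h0 : tau (m + 1) (heckeIncl m b * (lastGen m * heckeIncl m (jucysMurphy m))) = 0 :=
    tau_eq_zero_of_mem_twoSided (Submodule.subset_span ⟨_, _, (mul_assoc _ _ _).symm⟩)
  rw [e, mul_sub, mul_add, mul_one, mul_smul_comm, map_sub, map_add,
    map_smul, h0, tau_incl_mul_jucysMurphy, tau_heckeIncl]
  simp

theorem ocneanu_heckeIncl {m : ℕ} (a : Hecke m) :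
    ocneanu (m + 1) (heckeIncl m a) = ocneanu m a := by
  have h : ∀ k, tau (m + 1) (esymmJM (m + 1) k * heckeIncl m a) = tau m (esymmJM m k * a) := by
    rintro (_ | k)
    · rw [esymmJM_zero, esymmJM_zero, one_mul, one_mul, tau_heckeIncl]
    · rw [esymmJM_succ_succ, add_mul, mul_assoc, (jucysMurphy_commute m a).eq, ← mul_assoc,
        ← map_mul, ← map_mul, map_add, tau_incl_mul_jucysMurphy, tau_heckeIncl, add_zero]
  simp only [ocneanu_apply, h]
  -- The extra top term vanishes: there are only m elements on m + 1 strands.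
  rw [Finset.sum_range_succ _ (m + 1), esymmJM_eq_zero (Nat.lt_succ_self m)]
  simp

/-- Multiplying by g lowers the degree k by one under `tau`, so the sum shifts and gains a factor T
- z. -/
theorem ocneanu_heckeIncl_mul_lastGen {m : ℕ} (a : Hecke m) :
    ocneanu (m + 1) (heckeIncl m a * lastGen m) = (X - C X) * ocneanu m a := by
  have h0 : tau (m + 1) (esymmJM (m + 1) 0 * (heckeIncl m a * lastGen m)) = 0 := by
    rw [esymmJM_zero, one_mul, tau_heckeIncl_mul_lastGen]
  have h : ∀ k, tau (m + 1) (esymmJM (m + 1) (k + 1) * (heckeIncl m a * lastGen m)) =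
      tau m (esymmJM m k * a) := by
    intro k
    have hj : jucysMurphy (m + 1) * (heckeIncl m a * lastGen m) =
        heckeIncl m a * (jucysMurphy (m + 1) * lastGen m) := by
      rw [← mul_assoc, (jucysMurphy_commute m a).eq, mul_assoc]
    rw [esymmJM_succ_succ, add_mul, mul_assoc, hj, ← mul_assoc, ← mul_assoc, ← map_mul,
      ← map_mul, map_add, tau_heckeIncl_mul_lastGen, tau_incl_mul_jucysMurphy_mul_lastGen,
      zero_add]
  rw [ocneanu_apply, Finset.sum_range_succ', h0]
  simp only [h, map_zero, mul_zero, add_zero, ocneanu_apply, Finset.mul_sum]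
  exact Finset.sum_congr rfl fun k _ => by ring

theorem isOcneanuTrace_ocneanu : IsOcneanuTrace ocneanu where
  one m := by
    induction m with
    | zero => simp [ocneanu_apply, esymmJM_zero, tau_apply, coords_one]
    | succ m ih => rw [← map_one (heckeIncl m), ocneanu_heckeIncl, ih]
  comm _ := ocneanu_mul_comm
  incl _ := ocneanu_heckeIncl
  markov m a := by
    rw [toHecke_sigma, mul_add, map_add]
    have h : heckeIncl m a * zH (m + 1) = heckeIncl m ((X : ℤ[X]) • a) := by
      rw [zH, ← Algebra.commutes, ← Algebra.smul_def, map_smul]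
    rw [h, ocneanu_heckeIncl, map_smul, smul_eq_C_mul]
    change ocneanu (m + 1) (heckeIncl m a * lastGen m) + _ = _
    rw [ocneanu_heckeIncl_mul_lastGen]
    ring

/-- On a g b, cyclicity brings b next to a, and the Markov property reduces to one strand fewer. -/
theorem IsOcneanuTrace.eq_ocneanu {Tr : ∀ m : ℕ, Hecke m →ₗ[ℤ[X]] ℤ[X][X]}
    (h : IsOcneanuTrace Tr) : Tr = ocneanu := by
  funext m
  have h' := isOcneanuTrace_ocneanu
  have key : ∀ {Tr : ∀ m : ℕ, Hecke m →ₗ[ℤ[X]] ℤ[X][X]} (_ : IsOcneanuTrace Tr) (m : ℕ)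
      (a : Hecke m), Tr (m + 1) (heckeIncl m a * lastGen m) = (X - C X) * Tr m a := by
    intro Tr h m a
    have hm := h.markov m a
    rw [toHecke_sigma, mul_add, map_add, zH, ← Algebra.commutes, ← Algebra.smul_def, map_smul,
      h.incl, smul_eq_C_mul] at hm
    rw [sub_mul]
    exact eq_sub_of_add_eq hm
  induction m with
  | zero =>
    ext1 x
    obtain ⟨r, rfl⟩ := x.exists_algebraMap
    rw [Algebra.algebraMap_eq_smul_one, map_smul, map_smul, h.one, h'.one]
  | succ m ih =>
    ext1 x
    induction x using Hecke.induction_last with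
    | incl a => rw [h.incl, h'.incl, ih]
    | mid a b =>
      rw [h.comm, h'.comm, ← mul_assoc, ← map_mul, key h, key h', ih]
    | add x y hx hy => rw [map_add, map_add, hx, hy]

/-! ### The left column is the value at T = z. -/

theorem leftColumn_eq (Tr : ∀ m : ℕ, Hecke m →ₗ[ℤ[X]] ℤ[X][X]) (m : ℕ) (x : Hecke m) :
    leftColumn Tr m x = algebraMap ℤ[X] K ((Tr m x).eval X) := by
  set z : K := algebraMap ℤ[X] K X with hz
  have hz0 : z ≠ 0 := by
    rw [hz, Ne, FaithfulSMul.algebraMap_eq_zero_iff]; exact X_ne_zero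
  let Q : PowerSeries K := 1 - PowerSeries.X ^ 2
  have hQc : PowerSeries.constantCoeff Q = 1 := by simp [Q]
  have hQ : Q * Q⁻¹ = 1 := PowerSeries.mul_inv_cancel _ (by rw [hQc]; exact one_ne_zero)
  let ι := HahnSeries.ofPowerSeries ℤ K
  have hv : vVar = ι PowerSeries.X := (HahnSeries.ofPowerSeries_X).symm
  have hQv : ι Q = 1 - vVar ^ 2 := by simp [Q, hv]
  have hzc : zConst = (ι.comp PowerSeries.C).comp (algebraMap ℤ[X] K) := by
    refine RingHom.ext fun r => ?_
    simp [zConst, ι]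
  have hzv : zVar = ι (PowerSeries.C z) := by rw [zVar, hzc]; rfl
  have hinv : (1 - vVar ^ 2)⁻¹ = ι Q⁻¹ := by
    rw [inv_eq_iff_eq_inv, eq_comm, inv_eq_iff_eq_inv]
    refine eq_inv_of_mul_eq_one_right ?_
    rw [← hQv, ← map_mul, hQ, map_one]
  -- With Q = 1 - v² this factor is v⁻¹ Q / z, so H_x is v^(-m) times a power series, and the
  -- coefficient sought is the constant term of that series.
  have hfac : (vVar⁻¹ - vVar) / zVar =
      HahnSeries.single (-1) 1 * ι (Q * PowerSeries.C z⁻¹) := by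
    have h1 : (HahnSeries.single (-1 : ℤ) (1 : K)) = vVar⁻¹ := by
      simp [vVar, HahnSeries.inv_single]
    have h2 : ι (PowerSeries.C z⁻¹) = zVar⁻¹ := by
      refine eq_inv_of_mul_eq_one_left ?_
      rw [hzv, ← map_mul, ← map_mul, inv_mul_cancel₀ hz0, map_one, map_one]
    rw [map_mul, h1, h2, hQv]
    field_simp
  have hev : (Tr m x).eval₂ zConst (zVar / (1 - vVar ^ 2)) =
      ι ((Tr m x).eval₂ (PowerSeries.C.comp (algebraMap ℤ[X] K)) (PowerSeries.C z * Q⁻¹)) := by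
    rw [div_eq_mul_inv, hinv, hzv, ← map_mul, hzc, hom_eval₂]
    rfl
  have hcc : ∀ F : PowerSeries K, (HahnSeries.single (-(m : ℤ)) (1 : K) * ι F).coeff (-(m : ℤ)) =
      PowerSeries.constantCoeff F := by
    intro F
    have := HahnSeries.coeff_single_mul_add (r := (1 : K)) (x := ι F) (a := 0) (b := -(m : ℤ))
    rw [zero_add, one_mul] at this
    rw [this, ← PowerSeries.coeff_zero_eq_constantCoeff_apply]
    exact HahnSeries.ofPowerSeries_apply_coeff F 0
  have hQi : PowerSeries.constantCoeff Q⁻¹ = 1 := by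
    rw [PowerSeries.constantCoeff_inv, hQc, inv_one]
  have hcomp : (PowerSeries.constantCoeff.comp PowerSeries.C).comp (algebraMap ℤ[X] K) =
      algebraMap ℤ[X] K := by
    refine RingHom.ext fun r => ?_
    simp
  rw [leftColumn, framedHomfly, hfac, hev, mul_pow, HahnSeries.single_pow, ← map_pow ι, mul_assoc,
    ← map_mul ι, one_pow, nsmul_eq_mul, mul_neg_one, hcc, map_mul, hom_eval₂, map_mul, map_pow,
    map_mul, hQi, hQc, PowerSeries.constantCoeff_C, PowerSeries.constantCoeff_C, one_mul, mul_one,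
    ← RingHom.comp_assoc, hcomp, ← mul_assoc, ← hz, ← mul_pow, mul_inv_cancel₀ hz0, one_pow,
    one_mul, hz, eval₂_at_apply]

end HeckeInner

theorem mainTheorem1 :
    -- Ocneanu's trace exists and is unique
    (∃! Tr : ∀ m : ℕ, HeckeInner.Hecke m →ₗ[Polynomial ℤ] Polynomial (Polynomial ℤ),
      HeckeInner.IsOcneanuTrace Tr) ∧
    ∀ Tr : ∀ m : ℕ, HeckeInner.Hecke m →ₗ[Polynomial ℤ] Polynomial (Polynomial ℤ),
      HeckeInner.IsOcneanuTrace Tr → ∀ m : ℕ,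
        -- the negative permutation braids form a basis of the Hecke algebra on `m + 1` strands
        (∃ b : Module.Basis (Equiv.Perm (Fin (m + 1))) (Polynomial ℤ) (HeckeInner.Hecke m),
          ∀ π : Equiv.Perm (Fin (m + 1)),
            b π = HeckeInner.toHecke m (HeckeInner.negPermBraid π)) ∧
        -- which is orthonormal with respect to the left inner product
        ∀ π κ : Equiv.Perm (Fin (m + 1)),
          HeckeInner.leftInner Tr m
            (HeckeInner.toHecke m (HeckeInner.negPermBraid π))
            (HeckeInner.toHecke m (HeckeInner.negPermBraid κ)) = if π = κ then 1 else 0 := by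
  refine ⟨⟨HeckeInner.ocneanu, HeckeInner.isOcneanuTrace_ocneanu, fun Tr h => h.eq_ocneanu⟩,
    fun Tr h m => ⟨⟨HeckeInner.negPermBasis m, HeckeInner.negPermBasis_apply⟩, fun π κ => ?_⟩⟩
  obtain rfl := h.eq_ocneanu
  rw [HeckeInner.leftInner, LinearMap.mk₂_apply, HeckeInner.leftColumn_eq,
    HeckeInner.eval_ocneanu, HeckeInner.tau_mul_heckeRev, HeckeInner.coords_negPermBraid,
    HeckeInner.coords_negPermBraid, single_one_dotProduct, Pi.single_apply]
  split_ifs <;> simp
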